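/- Let $A$ be a separable C$^*$-algebra with a densely defined, faithful, semifinite, lower semicontinuous, positive trace $\tau$; let $L^2(A,\tau)$ be its G.N.S. Hilbert space, $L^2_+(A,\tau)$ the standard positive cone (the closure in $L^2(A,\tau)$ of $A_+\cap L^2(A,\tau)$), and $J$ the continuous extension of $a\mapsto a^*$ to $L^2(A,\tau)$. Let $(\mathcal E,\mathcal F)$ be a C$^*$-Dirichlet form on $L^2(A,\tau)$, i.e. a closed, densely defined, nonnegative quadratic form which satisfies the following. (a) It is real: $J\xi\in\mathcal F$ and $\mathcal E[J\xi]=\mathcal E[\xi]$ for all $\xi\in\mathcal F$. (b) It is Markovian: $\xi\wedge 1\in\mathcal F$ and $\mathcal E[\xi\wedge 1]\le\mathcal E[\xi]$ for all $\xi=J\xi\in\mathcal F$, where $\xi\wedge 1$ is the Hilbert projection of $\xi$ onto the $L^2$-closure of $\{a=a^*\in A\cap L^2(A,\tau): a\le 1\}$. (c) For all $n\ge 1$, the extension $\mathcal E_n[[\xi_{ij}]]=\sum_{i,j}\mathcal E[\xi_{ij}]$ to $L^2(\mathbb M_n(A),\tau\otimes \mathrm{tr}_n)$, with domain $\mathbb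 M_n(\mathcal F)$, has the same properties (a) and (b). (d) It is regular: $\mathcal B:=A\cap\mathcal F$ is norm dense in $A$ and is a form core for $(\mathcal E,\mathcal F)$. Put $\langle\xi,\eta\rangle_{\mathcal F}=\mathcal E(\xi,\eta)+(\xi,\eta)_{L^2(A,\tau)}$ for $\xi,\eta\in\mathcal F$. Let $$\mathcal P=\{\xi\in\mathcal F:\ \langle\xi,b\rangle_{\mathcal F}\ge 0\ \text{ for all } b\in\mathcal B\cap L^2_+(A,\tau)\}$$ be the cone of potentials. Then every potential is positive: $$\mathcal P\subseteq L^2_+(A,\tau).$$ -/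

import Mathlib

open scoped NNReal ENNReal ComplexOrder

noncomputable section

namespace NCPotential

/-! ### Traces on a C*-algebra -/

/-- A densely defined, faithful, semifinite, lower semicontinuous, positive trace on the
C*-algebra `A`, i.e. a weight `τ : A₊ → [0, ∞]`.  Only the values of `toFun` on `A₊` matter. -/
structure CStarTrace (A : Type*) [NonUnitalCStarAlgebra A] [PartialOrder A]
    [StarOrderedRing A] where
  toFun : A → ℝ≥0∞
  map_add : ∀ a b : A, 0 ≤ a → 0 ≤ b → toFun (a + b) = toFun a + toFun b
  map_smul : ∀ (r : ℝ≥0) (a : A), 0 ≤ a → toFun ((r : ℝ) • a) = (r : ℝ≥0∞) * toFun a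
  tracial : ∀ a : A, toFun (star a * a) = toFun (a * star a)
  faithful : ∀ a : A, 0 ≤ a → toFun a = 0 → a = 0
  lowerSemicontinuous : LowerSemicontinuousOn toFun {a : A | 0 ≤ a}
  semifinite : ∀ a : A, 0 ≤ a →
    IsLUB (toFun '' {b : A | 0 ≤ b ∧ b ≤ a ∧ toFun b < ∞}) (toFun a)
  denselyDefined : Dense (Submodule.span ℂ {a : A | 0 ≤ a ∧ toFun a < ∞} : Set A)

namespace CStarTrace

variable {A : Type*} [NonUnitalCStarAlgebra A] [PartialOrder A] [StarOrderedRing A]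
variable (τ : CStarTrace A)

instance : CoeFun (CStarTrace A) (fun _ => A → ℝ≥0∞) := ⟨CStarTrace.toFun⟩

theorem map_zero : τ 0 = 0 := by
  have h := τ.map_smul 0 0 le_rfl
  simpa using h

theorem mono {a b : A} (ha : 0 ≤ a) (hab : a ≤ b) : τ a ≤ τ b := by
  have h := τ.map_add a (b - a) ha (sub_nonneg.2 hab)
  rw [add_sub_cancel] at h
  rw [h]
  exact le_self_add

theorem map_star_smul_mul (c : ℂ) (a : A) :
    τ (star (c • a) * (c • a)) = (‖c‖₊ : ℝ≥0∞) ^ 2 * τ (star a * a) := by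
  have h : star (c • a) * (c • a) = ((‖c‖₊ ^ 2 : ℝ≥0) : ℝ) • (star a * a) := by
    rw [star_smul, smul_mul_smul_comm, ← Complex.coe_smul]
    congr 1
    simp [Complex.conj_mul']
  rw [h, τ.map_smul _ _ (star_mul_self_nonneg a)]
  simp

theorem parallelogram (a b : A) :
    τ (star (a + b) * (a + b)) + τ (star (a - b) * (a - b)) =
      2 * (τ (star a * a) + τ (star b * b)) := by
  rw [← τ.map_add _ _ (star_mul_self_nonneg _) (star_mul_self_nonneg _)]
  have h : star (a + b) * (a + b) + star (a - b) * (a - b)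
      = (star a * a + star b * b) + (star a * a + star b * b) := by
    simp only [star_add, star_sub, add_mul, mul_add, sub_mul, mul_sub]
    abel
  rw [h, τ.map_add _ _ (add_nonneg (star_mul_self_nonneg _) (star_mul_self_nonneg _))
    (add_nonneg (star_mul_self_nonneg _) (star_mul_self_nonneg _)),
    τ.map_add _ _ (star_mul_self_nonneg _) (star_mul_self_nonneg _), two_mul]

/-- The ideal `A ∩ L²(A, τ)` of square integrable elements, `τ(a* a) < ∞`. -/
def sqInt : Submodule ℂ A where
  carrier := {a | τ (star a * a) < ∞}
  zero_mem' := by simp [τ.map_zero]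
  add_mem' := by
    intro a b ha hb
    have h := τ.parallelogram a b
    refine lt_of_le_of_lt (le_self_add.trans h.le) ?_
    exact ENNReal.mul_lt_top (by simp) (ENNReal.add_lt_top.2 ⟨ha, hb⟩)
  smul_mem' := by
    intro c a ha
    change τ _ < ∞
    rw [τ.map_star_smul_mul]
    exact ENNReal.mul_lt_top (by simp) ha

theorem mem_sqInt {a : A} : a ∈ τ.sqInt ↔ τ (star a * a) < ∞ := Iff.rfl

theorem star_mem_sqInt {a : A} (ha : a ∈ τ.sqInt) : star a ∈ τ.sqInt := by
  rw [mem_sqInt, star_star, ← τ.tracial]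
  exact ha

/-! ### The G.N.S. Hilbert space -/

/-- `A ∩ L²(A, τ)` as a pre-Hilbert space: a type synonym of `sqInt`, carrying the norm
`‖a‖₂ = τ(a* a)^{1/2}` instead of the norm of `A`. -/
def PreL2 : Type _ := τ.sqInt

instance : AddCommGroup τ.PreL2 := inferInstanceAs (AddCommGroup τ.sqInt)

instance : Module ℂ τ.PreL2 := inferInstanceAs (Module ℂ τ.sqInt)

/-- The element of `A` underlying an element of `PreL2`. -/
def PreL2.val {τ : CStarTrace A} (a : τ.PreL2) : A := Subtype.val (p := (· ∈ τ.sqInt)) a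

/-- A square integrable element of `A`, as an element of `PreL2`. -/
def PreL2.mk {τ : CStarTrace A} (a : A) (ha : a ∈ τ.sqInt) : τ.PreL2 := (⟨a, ha⟩ : τ.sqInt)

instance : Norm τ.PreL2 := ⟨fun a => Real.sqrt (τ (star a.val * a.val)).toReal⟩

theorem norm_sq (a : τ.PreL2) : ‖a‖ ^ 2 = (τ (star a.val * a.val)).toReal :=
  Real.sq_sqrt ENNReal.toReal_nonneg

theorem preL2_parallelogram (a b : τ.PreL2) :
    ‖a + b‖ ^ 2 + ‖a - b‖ ^ 2 = 2 * (‖a‖ ^ 2 + ‖b‖ ^ 2) := by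
  simp only [norm_sq]
  have h := congrArg ENNReal.toReal (τ.parallelogram a.val b.val)
  have f1 : τ (star (a.val + b.val) * (a.val + b.val)) ≠ ∞ := (a + b).2.ne
  have f2 : τ (star (a.val - b.val) * (a.val - b.val)) ≠ ∞ := (a - b).2.ne
  have f3 : τ (star a.val * a.val) ≠ ∞ := a.2.ne
  have f4 : τ (star b.val * b.val) ≠ ∞ := b.2.ne
  rw [ENNReal.toReal_add f1 f2, ENNReal.toReal_mul, ENNReal.toReal_add f3 f4,
    ENNReal.toReal_ofNat] at h
  exact h

theorem preL2_norm_smul (c : ℂ) (a : τ.PreL2) : ‖c • a‖ = ‖c‖ * ‖a‖ := by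
  have h := congrArg ENNReal.toReal (τ.map_star_smul_mul c a.val)
  have h2 : ‖c • a‖ ^ 2 = (‖c‖ * ‖a‖) ^ 2 := by
    rw [mul_pow, norm_sq, norm_sq]
    rw [ENNReal.toReal_mul, ENNReal.toReal_pow, ENNReal.coe_toReal, coe_nnnorm] at h
    exact h
  exact (pow_left_inj₀ (Real.sqrt_nonneg _)
    (mul_nonneg (norm_nonneg _) (Real.sqrt_nonneg _)) two_ne_zero).1 h2

theorem preL2_young (a b : τ.PreL2) {t : ℝ} (ht : 0 < t) :
    ‖a + b‖ ^ 2 ≤ (1 + t) * ‖a‖ ^ 2 + (1 + t⁻¹) * ‖b‖ ^ 2 := by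
  -- compare with the parallelogram identity for the rescaled elements
  set s : ℝ := Real.sqrt t with hs
  have hs0 : 0 < s := Real.sqrt_pos.2 ht
  have hst : s ^ 2 = t := Real.sq_sqrt ht.le
  have key : star (a + b).val * (a + b).val
      + star ((s : ℂ) • a.val - ((s⁻¹ : ℝ) : ℂ) • b.val)
        * ((s : ℂ) • a.val - ((s⁻¹ : ℝ) : ℂ) • b.val)
      = star a.val * a.val + star b.val * b.val
        + star ((s : ℂ) • a.val) * ((s : ℂ) • a.val)
        + star (((s⁻¹ : ℝ) : ℂ) • b.val) * (((s⁻¹ : ℝ) : ℂ) • b.val) := by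
    have e : (a + b).val = a.val + b.val := rfl
    have h1 : (s : ℂ) * ((s⁻¹ : ℝ) : ℂ) = 1 := by
      rw [← Complex.ofReal_mul, mul_inv_cancel₀ hs0.ne', Complex.ofReal_one]
    have h2 : ((s⁻¹ : ℝ) : ℂ) * (s : ℂ) = 1 := by rw [mul_comm, h1]
    rw [e]
    simp only [star_add, star_sub, add_mul, mul_add, sub_mul, mul_sub, star_smul,
      smul_mul_smul_comm, Complex.star_def, Complex.conj_ofReal, h1, h2, one_smul]
    abel
  set d : A := (s : ℂ) • a.val - ((s⁻¹ : ℝ) : ℂ) • b.val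
  have P := fun x : A => star_mul_self_nonneg x
  have h := congrArg τ.toFun key
  rw [τ.map_add _ _ (P _) (P _),
    τ.map_add _ _ (add_nonneg (add_nonneg (P _) (P _)) (P _)) (P _),
    τ.map_add _ _ (add_nonneg (P _) (P _)) (P _), τ.map_add _ _ (P _) (P _),
    τ.map_star_smul_mul, τ.map_star_smul_mul] at h
  have h3 : τ (star (a + b).val * (a + b).val) ≤ _ := le_self_add.trans h.le
  have fa : τ (star a.val * a.val) ≠ ∞ := a.2.ne
  have fb : τ (star b.val * b.val) ≠ ∞ := b.2.ne
  have fs : (‖(s : ℂ)‖₊ : ℝ≥0∞) ^ 2 * τ (star a.val * a.val) ≠ ∞ :=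
    ENNReal.mul_ne_top (by simp) fa
  have fs' : (‖((s⁻¹ : ℝ) : ℂ)‖₊ : ℝ≥0∞) ^ 2 * τ (star b.val * b.val) ≠ ∞ :=
    ENNReal.mul_ne_top (by simp) fb
  have h4 := ENNReal.toReal_mono
    (ENNReal.add_ne_top.2 ⟨ENNReal.add_ne_top.2 ⟨ENNReal.add_ne_top.2 ⟨fa, fb⟩, fs⟩, fs'⟩) h3
  rw [ENNReal.toReal_add (ENNReal.add_ne_top.2 ⟨ENNReal.add_ne_top.2 ⟨fa, fb⟩, fs⟩) fs',
    ENNReal.toReal_add (ENNReal.add_ne_top.2 ⟨fa, fb⟩) fs, ENNReal.toReal_add fa fb,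
    ENNReal.toReal_mul, ENNReal.toReal_mul] at h4
  simp only [norm_sq]
  have e1 : ((‖(s : ℂ)‖₊ : ℝ≥0∞) ^ 2).toReal = t := by
    rw [← hst]; simp
  have e2 : ((‖((s⁻¹ : ℝ) : ℂ)‖₊ : ℝ≥0∞) ^ 2).toReal = t⁻¹ := by
    rw [← hst]; simp
  rw [e1, e2] at h4
  linarith

theorem preL2_norm_eq_zero (a : τ.PreL2) : ‖a‖ = 0 ↔ a = 0 := by
  constructor
  · intro h
    have h1 : (τ (star a.val * a.val)).toReal = 0 := by rw [← norm_sq, h]; simp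
    have h2 : τ (star a.val * a.val) = 0 :=
      ((ENNReal.toReal_eq_zero_iff _).1 h1).resolve_right a.2.ne
    have h3 := τ.faithful _ (star_mul_self_nonneg _) h2
    exact Subtype.ext ((CStarRing.star_mul_self_eq_zero_iff _).1 h3)
  · rintro rfl
    have : ‖(0 : τ.PreL2)‖ = ‖(0 : ℂ) • (0 : τ.PreL2)‖ := by simp
    rw [this, preL2_norm_smul]
    simp

theorem preL2_triangle (a b : τ.PreL2) : ‖a + b‖ ≤ ‖a‖ + ‖b‖ := by
  have na : 0 ≤ ‖a‖ := Real.sqrt_nonneg _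
  have nb : 0 ≤ ‖b‖ := Real.sqrt_nonneg _
  rcases na.eq_or_lt with ha | ha
  · rw [(τ.preL2_norm_eq_zero a).1 ha.symm, zero_add]
    exact le_add_of_nonneg_left (Real.sqrt_nonneg _)
  rcases nb.eq_or_lt with hb | hb
  · rw [(τ.preL2_norm_eq_zero b).1 hb.symm, add_zero]
    exact le_add_of_nonneg_right (Real.sqrt_nonneg _)
  have h := τ.preL2_young a b (div_pos hb ha)
  refine abs_le_of_sq_le_sq' ?_ (add_nonneg na nb) |>.2
  refine h.trans (le_of_eq ?_)
  field_simp
  ring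

theorem preL2_core : NormedSpace.Core ℂ τ.PreL2 where
  norm_nonneg _ := Real.sqrt_nonneg _
  norm_smul := τ.preL2_norm_smul
  norm_triangle := τ.preL2_triangle
  norm_eq_zero_iff := τ.preL2_norm_eq_zero

instance : NormedAddCommGroup τ.PreL2 := NormedAddCommGroup.ofCore τ.preL2_core

instance : NormedSpace ℂ τ.PreL2 := NormedSpace.ofCore τ.preL2_core

/-- The inner product of `PreL2`, recovered from the norm `‖a‖₂ = τ(a* a)^{1/2}` by polarization;
it is `⟪a, b⟫ = τ(a* b)`. -/
instance : InnerProductSpace ℂ τ.PreL2 :=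
  InnerProductSpace.ofNorm ℂ (fun a b => by
    simpa only [← pow_two] using τ.preL2_parallelogram a b)

/-- The G.N.S. Hilbert space `L²(A, τ)`. -/
abbrev L2 : Type _ := UniformSpace.Completion τ.PreL2

/-- The canonical image in `L²(A, τ)` of a square integrable element of `A`. -/
def toL2 (a : A) (ha : a ∈ τ.sqInt) : τ.L2 :=
  ((PreL2.mk a ha : τ.PreL2) : UniformSpace.Completion τ.PreL2)

theorem norm_toL2_sq (a : A) (ha : a ∈ τ.sqInt) :
    ‖τ.toL2 a ha‖ ^ 2 = (τ (star a * a)).toReal := by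
  rw [toL2, UniformSpace.Completion.norm_coe]
  exact τ.norm_sq _

/-- The involution `a ↦ a*` on `A ∩ L²(A, τ)`. -/
def preJ (a : τ.PreL2) : τ.PreL2 := PreL2.mk (star a.val) (τ.star_mem_sqInt a.2)

theorem preJ_isometry : Isometry τ.preJ := by
  refine Isometry.of_dist_eq fun a b => ?_
  have h : ‖τ.preJ a - τ.preJ b‖ ^ 2 = ‖a - b‖ ^ 2 := by
    rw [norm_sq, norm_sq]
    have e : (τ.preJ a - τ.preJ b).val = star (a - b).val := (star_sub a.val b.val).symm
    rw [e, star_star, ← τ.tracial]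
  rw [dist_eq_norm, dist_eq_norm]
  exact (pow_left_inj₀ (norm_nonneg _) (norm_nonneg _) two_ne_zero).1 h

/-- The modular conjugation `J` on `L²(A, τ)`: the continuous extension of `a ↦ a*`. -/
def J : τ.L2 → τ.L2 := UniformSpace.Completion.map τ.preJ

theorem J_toL2 (a : A) (ha : a ∈ τ.sqInt) :
    τ.J (τ.toL2 a ha) = τ.toL2 (star a) (τ.star_mem_sqInt ha) :=
  UniformSpace.Completion.map_coe τ.preJ_isometry.uniformContinuous (PreL2.mk a ha)

/-- The standard cone `L²₊(A, τ)`: the closure in `L²(A, τ)` of `A₊ ∩ L²(A, τ)`. -/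
def posCone : Set τ.L2 :=
  closure {ξ | ∃ (a : A) (ha : a ∈ τ.sqInt), 0 ≤ a ∧ τ.toL2 a ha = ξ}

/-- For an element `a` of a C*-algebra: `a = a*` and `a ≤ 1`, where `1` is the unit of any
unital C*-algebra containing `a`, such as the unitization or the generated von Neumann algebra
(so `0` is always included in the spectrum, which does not affect the bound by `1`). -/
def SelfAdjointLeOne {B : Type*} [NonUnitalRing B] [StarRing B] [Module ℝ B] (a : B) : Prop :=
  IsSelfAdjoint a ∧ ∀ x ∈ quasispectrum ℝ a, x ≤ 1

/-- The closed convex set `C` onto which `ξ ↦ ξ ∧ 1` projects: the `L²`-closure of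
`{a ∈ A ∩ L²(A, τ) : a = a*, a ≤ 1}`. -/
def leOneSet : Set τ.L2 :=
  closure {ξ | ∃ (a : A) (ha : a ∈ τ.sqInt), SelfAdjointLeOne a ∧ τ.toL2 a ha = ξ}

/-! ### Matrix amplifications -/

/-- `L²(M_n(A), τ ⊗ tr_n)`, as the space of `n × n` matrices with entries in `L²(A, τ)`.  The
normalization `1 / n` of the squared norm is dropped; it changes neither metric projections nor
inequalities between energies. -/
abbrev MatL2 (n : ℕ) : Type _ := PiLp 2 (fun _ : Fin n × Fin n => τ.L2)

/-- The modular conjugation of `L²(M_n(A), τ ⊗ tr_n)`, extending `[a i j] ↦ [(a j i)*]`. -/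
def matJ (n : ℕ) (ξ : τ.MatL2 n) : τ.MatL2 n :=
  WithLp.toLp 2 (fun p => τ.J (ξ (p.2, p.1)))

/-- The closed convex set of `leOneSet`, for `(M_n(A), τ ⊗ tr_n)`: the `L²`-closure of the set of
the square integrable `a = a* ∈ M_n(A)` with `a ≤ 1`. -/
def matLeOneSet (n : ℕ) : Set (τ.MatL2 n) :=
  closure {ξ | ∃ (a : CStarMatrix (Fin n) (Fin n) A) (ha : ∀ i j, a i j ∈ τ.sqInt),
    SelfAdjointLeOne a ∧ ∀ i j, ξ (i, j) = τ.toL2 (a i j) (ha i j)}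

end CStarTrace

/-! ### Quadratic forms on a Hilbert space -/

/-- A sesquilinear form with a domain in `H`, conjugate linear in the first variable. -/
structure SesqForm (H : Type*) [NormedAddCommGroup H] [InnerProductSpace ℂ H] where
  domain : Submodule ℂ H
  form : domain →ₗ⋆[ℂ] domain →ₗ[ℂ] ℂ

namespace SesqForm

variable {H : Type*} [NormedAddCommGroup H] [InnerProductSpace ℂ H] (E : SesqForm H)

/-- The quadratic form `E[ξ] = E(ξ, ξ)`. -/
def energy (ξ : E.domain) : ℝ := (E.form ξ ξ).re

/-- `⟨ξ, η⟩_F = E(ξ, η) + (ξ, η)`. -/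
def graphInner (ξ η : E.domain) : ℂ := E.form ξ η + inner ℂ (ξ : H) (η : H)

/-- `E(ξ, ξ)` is real and `≥ 0`, for all `ξ` in the domain. -/
def IsNonneg : Prop := ∀ ξ : E.domain, 0 ≤ E.form ξ ξ

/-- Closedness: a sequence in the domain which converges in `H` and is Cauchy with respect to the
form has its limit in the domain and converges to it with respect to the form. -/
def IsClosedForm : Prop :=
  ∀ (u : ℕ → E.domain) (ξ : H),
    Filter.Tendsto (fun k => (u k : H)) Filter.atTop (nhds ξ) →
    (∀ ε : ℝ, 0 < ε → ∃ N, ∀ k ≥ N, ∀ l ≥ N, E.energy (u k - u l) < ε) →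
    ∃ hξ : ξ ∈ E.domain,
      Filter.Tendsto (fun k => E.energy (u k - ⟨ξ, hξ⟩)) Filter.atTop (nhds 0)

/-- `η` is the metric (Hilbert) projection of `ξ` on `C`. -/
def IsProjection (C : Set H) (ξ η : H) : Prop :=
  η ∈ C ∧ ∀ ζ ∈ C, ‖ξ - η‖ ≤ ‖ξ - ζ‖

/-- `E` is real, with respect to the conjugation `J`. -/
def IsReal (J : H → H) : Prop :=
  ∀ ξ : E.domain, ∃ h : J ξ ∈ E.domain, E.energy ⟨J ξ, h⟩ = E.energy ξ

/-- `E` is Markovian: for real `ξ` in the domain, the metric projection `ξ ∧ 1` of `ξ` on the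
closed convex set `C` is in the domain and `E[ξ ∧ 1] ≤ E[ξ]`. -/
def IsMarkovian (J : H → H) (C : Set H) : Prop :=
  ∀ ξ : E.domain, J ξ = ξ →
    ∃ η : E.domain, IsProjection C (ξ : H) (η : H) ∧ E.energy η ≤ E.energy ξ

/-- `E` is a Dirichlet form: closed, densely defined, nonnegative, real and Markovian. -/
structure IsDirichlet (J : H → H) (C : Set H) : Prop where
  closed : E.IsClosedForm
  dense : Dense (E.domain : Set H)
  nonneg : E.IsNonneg
  real : E.IsReal J
  markovian : E.IsMarkovian J C

/-- The extension `E_n([ξ i j], [η i j]) = ∑ i j, E(ξ i j, η i j)` of `E` to matrices, with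
domain the matrices whose entries are in the domain of `E`. -/
def amplify (n : ℕ) : SesqForm (PiLp 2 (fun _ : Fin n × Fin n => H)) where
  domain :=
    { carrier := {ξ | ∀ p, ξ p ∈ E.domain}
      zero_mem' := fun _ => E.domain.zero_mem
      add_mem' := fun ha hb p => E.domain.add_mem (ha p) (hb p)
      smul_mem' := fun c _ ha p => E.domain.smul_mem c (ha p) }
  form := LinearMap.mk₂'ₛₗ (starRingEnd ℂ) (RingHom.id ℂ)
    (fun ξ η => ∑ p, E.form ⟨ξ.1 p, ξ.2 p⟩ ⟨η.1 p, η.2 p⟩)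
    (fun ξ ξ' η => by
      rw [← Finset.sum_add_distrib]
      refine Finset.sum_congr rfl fun p _ => ?_
      rw [← LinearMap.add_apply, ← map_add]
      rfl)
    (fun c ξ η => by
      rw [Finset.smul_sum]
      refine Finset.sum_congr rfl fun p _ => ?_
      rw [← LinearMap.smul_apply, ← map_smulₛₗ]
      rfl)
    (fun ξ η η' => by
      rw [← Finset.sum_add_distrib]
      refine Finset.sum_congr rfl fun p _ => ?_
      rw [← map_add]
      rfl)
    (fun c ξ η => by
      rw [Finset.smul_sum]
      refine Finset.sum_congr rfl fun p _ => ?_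
      rw [← map_smulₛₗ]
      rfl)

end SesqForm

/-! ### C*-Dirichlet forms and potentials -/

section Dirichlet

variable {A : Type*} [NonUnitalCStarAlgebra A] [PartialOrder A] [StarOrderedRing A]
variable (τ : CStarTrace A) (E : SesqForm τ.L2)

/-- The Dirichlet algebra `B = A ∩ F`, as a subset of `A`. -/
def dirichletAlgebra : Set A :=
  {a | ∃ ha : a ∈ τ.sqInt, τ.toL2 a ha ∈ E.domain}

/-- `E` is regular: `B` is dense in the C*-algebra `A` and is a form core, i.e. it is dense in the
domain of `E` with respect to the graph norm. -/
def IsRegular : Prop :=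
  Dense (dirichletAlgebra τ E) ∧
    ∀ (ξ : E.domain) (ε : ℝ), 0 < ε →
      ∃ (a : A) (ha : a ∈ τ.sqInt) (hE : τ.toL2 a ha ∈ E.domain),
        E.energy (ξ - ⟨τ.toL2 a ha, hE⟩) + ‖(ξ : τ.L2) - τ.toL2 a ha‖ ^ 2 < ε

/-- `E` is a C*-Dirichlet form on `L²(A, τ)`: a Dirichlet form, all of whose matrix amplifications
are Dirichlet forms (`n = 1` repeats the first condition), and which is regular. -/
structure IsCStarDirichlet : Prop where
  dirichlet : E.IsDirichlet τ.J τ.leOneSet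
  completely : ∀ n : ℕ, 1 ≤ n → (E.amplify n).IsDirichlet (τ.matJ n) (τ.matLeOneSet n)
  regular : IsRegular τ E

/-- The cone `P` of potentials: the `ξ ∈ F` with `⟨ξ, b⟩_F ≥ 0` for all
`b ∈ B₊ = B ∩ L²₊(A, τ)`. -/
def potentials : Set τ.L2 :=
  {ξ | ∃ hξ : ξ ∈ E.domain, ∀ (b : A) (hb : b ∈ τ.sqInt) (hE : τ.toL2 b hb ∈ E.domain),
    τ.toL2 b hb ∈ τ.posCone → 0 ≤ E.graphInner ⟨ξ, hξ⟩ ⟨τ.toL2 b hb, hE⟩}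

end Dirichlet

end NCPotential

end

noncomputable section

namespace NCPotential

namespace CStarTrace

variable {A : Type*} [NonUnitalCStarAlgebra A] [PartialOrder A] [StarOrderedRing A]
variable (τ : CStarTrace A)

/-! Let `ξ` be a potential and `b ∈ B` close to it in the graph norm. Replacing `b` by the positive
part of its real part does not increase the graph distance to `ξ`. As the graph norm dominates the
`L²` norm, `ξ` is then an `L²` limit of positive elements of `A`.

Write `b = h + ik`. A potential pairs with positive elements of `B` in nonnegative reals, hence with
`k = k⁺ - k⁻` in a real number. So `ik` is orthogonal to `ξ` for the real part of the graph inner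
product, and it is orthogonal to `h` because `E` and the trace are invariant under the involution.
Dropping `ik` thus decreases the distance. Passing from `h` to `h⁺` changes the squared distance by
`-2⟨ξ, h⁻⟩ + 2⟨h⁺, h⁻⟩ - ‖h⁻‖²` (real parts), where `⟨ξ, h⁻⟩ ≥ 0` by the definition of a potential.
What remains is `E(h⁺, h⁻) ≤ 0` (`re_form_posPart_negPart_nonpos`).

This follows from `E[b⁻] ≤ E[b]` (`energy_negPart_le`), applied to `s h⁺ - h⁻` with `s ↓ 0`. To get
that bound, let `ε ↓ 0` in `ε(b/ε ∧ 1)`, which tends to `-b⁻` in `L²` with energy at most `E[b]`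
(`exists_near_neg_negPart`); the energy of a closed form is lower semicontinuous
(`IsClosedForm.exists_energy_le`). The convergence uses only the minimality of the projection and
the pairing bound `Re(e, η) ≤ τ(e)` for `e ≥ 0` of finite trace and `η` in the closed set of
elements below `1`. -/

/-! ### The embedding of square integrable elements in `L²` -/

theorem toL2_add {a b : A} (ha : a ∈ τ.sqInt) (hb : b ∈ τ.sqInt) :
    τ.toL2 (a + b) (add_mem ha hb) = τ.toL2 a ha + τ.toL2 b hb :=
  UniformSpace.Completion.coe_add (PreL2.mk a ha) (PreL2.mk b hb)

theorem toL2_sub {a b : A} (ha : a ∈ τ.sqInt) (hb : b ∈ τ.sqInt) :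
    τ.toL2 (a - b) (sub_mem ha hb) = τ.toL2 a ha - τ.toL2 b hb :=
  UniformSpace.Completion.coe_sub (PreL2.mk a ha) (PreL2.mk b hb)

theorem toL2_smul (c : ℂ) {a : A} (ha : a ∈ τ.sqInt) :
    τ.toL2 (c • a) (τ.sqInt.smul_mem c ha) = c • τ.toL2 a ha :=
  UniformSpace.Completion.coe_smul c (PreL2.mk a ha)

theorem toL2_congr {a b : A} (h : a = b) (ha : a ∈ τ.sqInt) (hb : b ∈ τ.sqInt) :
    τ.toL2 a ha = τ.toL2 b hb := by
  subst h; rfl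

theorem real_smul_mem_sqInt (r : ℝ) {a : A} (ha : a ∈ τ.sqInt) : r • a ∈ τ.sqInt := by
  rw [← Complex.coe_smul]
  exact τ.sqInt.smul_mem _ ha

theorem toL2_real_smul (r : ℝ) {a : A} (ha : a ∈ τ.sqInt) :
    τ.toL2 (r • a) (τ.real_smul_mem_sqInt r ha) = (r : ℂ) • τ.toL2 a ha := by
  rw [← τ.toL2_smul]
  exact τ.toL2_congr (Complex.coe_smul r a).symm _ _

/-- Traciality: the norms of `a` and `a*` in `L²(A, τ)` agree. -/
theorem norm_toL2_star {a : A} (ha : a ∈ τ.sqInt) :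
    ‖τ.toL2 (star a) (τ.star_mem_sqInt ha)‖ = ‖τ.toL2 a ha‖ := by
  refine (pow_left_inj₀ (norm_nonneg _) (norm_nonneg _) two_ne_zero).1 ?_
  rw [norm_toL2_sq, norm_toL2_sq, star_star, ← τ.tracial]

/-! ### Functional calculus of square integrable elements -/

theorem mem_sqInt_of_le {a b : A} (hb : b ∈ τ.sqInt) (h : star a * a ≤ star b * b) :
    a ∈ τ.sqInt :=
  (τ.mono (star_mul_self_nonneg a) h).trans_lt hb

/-- Functional calculus gives `f(b)² ≤ b²`, and the trace is monotone. -/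
theorem cfcₙ_mem_sqInt {b : A} (hb : b ∈ τ.sqInt) (hsa : IsSelfAdjoint b) {f : ℝ → ℝ}
    (hf : Continuous f) (hf0 : f 0 = 0) (hle : ∀ x, |f x| ≤ |x|) : cfcₙ f b ∈ τ.sqInt := by
  refine τ.mem_sqInt_of_le hb ?_
  rw [(IsSelfAdjoint.cfcₙ (f := f) (a := b)).star_eq, hsa.star_eq,
    ← cfcₙ_mul f f b hf.continuousOn hf0 hf.continuousOn hf0]
  nth_rewrite 2 3 [← cfcₙ_id' ℝ b]
  rw [← cfcₙ_mul (fun x : ℝ => x) (fun x : ℝ => x) b]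
  exact cfcₙ_mono (fun x _ => abs_le_iff_mul_self_le.1 (hle x))
    (hf.mul hf).continuousOn (by fun_prop) (by simp [hf0]) (by simp)

theorem posPart_mem_sqInt {b : A} (hb : b ∈ τ.sqInt) (hsa : IsSelfAdjoint b) : b⁺ ∈ τ.sqInt := by
  refine τ.cfcₙ_mem_sqInt hb hsa (by fun_prop) (by simp) fun x => ?_
  rw [abs_of_nonneg (posPart_nonneg x)]
  exact sup_le (le_abs_self x) (abs_nonneg x)

theorem negPart_mem_sqInt {b : A} (hb : b ∈ τ.sqInt) (hsa : IsSelfAdjoint b) : b⁻ ∈ τ.sqInt := by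
  have h := sub_mem (τ.posPart_mem_sqInt hb hsa) hb
  rwa [show b⁺ - b = b⁻ from by rw [sub_eq_iff_eq_add, ← sub_eq_iff_eq_add',
    CFC.posPart_sub_negPart b hsa]] at h

/-! ### Inner products in `L²` computed from the trace -/

theorem re_inner_toL2 {a b : A} (ha : a ∈ τ.sqInt) (hb : b ∈ τ.sqInt) :
    (inner ℂ (τ.toL2 a ha) (τ.toL2 b hb)).re =
      ((τ (star (a + b) * (a + b))).toReal - (τ (star (a - b) * (a - b))).toReal) / 4 := by
  rw [← τ.norm_toL2_sq _ (add_mem ha hb), ← τ.norm_toL2_sq _ (sub_mem ha hb), toL2_add, toL2_sub]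
  have := re_inner_eq_norm_add_mul_self_sub_norm_sub_mul_self_div_four (𝕜 := ℂ)
    (τ.toL2 a ha) (τ.toL2 b hb)
  rw [pow_two, pow_two]
  exact this

theorem re_inner_toL2_eq_zero {a b : A} (ha : a ∈ τ.sqInt) (hb : b ∈ τ.sqInt)
    (h : star a * b = 0) : (inner ℂ (τ.toL2 a ha) (τ.toL2 b hb)).re = 0 := by
  have h' : star b * a = 0 := by
    have := congrArg star h
    simpa using this
  rw [τ.re_inner_toL2 ha hb]
  simp [add_mul, mul_add, sub_mul, mul_sub, h, h']

/-- `τ(x y) = τ(h y h)` if `x = h²` has finite trace. -/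
theorem re_inner_toL2_mul_self {h y : A} (hh : IsSelfAdjoint h) (hy : 0 ≤ y)
    (hx : h * h ∈ τ.sqInt) (hy' : y ∈ τ.sqInt) (hfin : τ (h * h) ≠ ∞) :
    (inner ℂ (τ.toL2 (h * h) hx) (τ.toL2 y hy')).re = (τ (h * y * h)).toReal := by
  have hys : IsSelfAdjoint y := .of_nonneg hy
  have hxs : star (h * h) = h * h := by rw [star_mul, hh.star_eq]
  have P (a : A) : 0 ≤ star a * a := star_mul_self_nonneg a
  have pos_hyh : 0 ≤ h * y * h := hh.conjugate_nonneg hy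
  have pos_yy : 0 ≤ y * y := by simpa [hys.star_eq] using P y
  have pos_hh : 0 ≤ h * h := by simpa [hh.star_eq] using P h
  have pos_hhhh : 0 ≤ h * h * (h * h) := by simpa [hxs] using P (h * h)
  have pos_hyyh : 0 ≤ h * (y * y) * h := hh.conjugate_nonneg pos_yy
  have e1 : τ (h * (y * y) * h) = τ (y * (h * h) * y) := by
    have := τ.tracial (y * h)
    simp only [star_mul, hh.star_eq, hys.star_eq] at this
    simpa [mul_assoc] using this
  have pos_yhhy : 0 ≤ y * (h * h) * y := hys.conjugate_nonneg pos_hh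
  have f1 : τ (y * (h * h) * y) ≠ ∞ := by
    have hle := CStarAlgebra.star_left_conjugate_le_norm_smul (a := y) (b := h * h)
    rw [hys.star_eq] at hle
    refine ((τ.mono pos_yhhy hle).trans_lt ?_).ne
    have := τ.map_smul ‖h * h‖₊ (y * y) pos_yy
    rw [coe_nnnorm] at this
    rw [this]
    have hyf : τ (star y * y) < ∞ := hy'
    rw [hys.star_eq] at hyf
    exact ENNReal.mul_lt_top (by simp) hyf
  have fy : τ (y * y) ≠ ∞ := by
    have hyf : τ (star y * y) < ∞ := hy'
    rw [hys.star_eq] at hyf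
    exact hyf.ne
  have fx : τ (h * h * (h * h)) ≠ ∞ := by
    have hxf : τ (star (h * h) * (h * h)) < ∞ := hx
    rw [hxs] at hxf
    exact hxf.ne
  have f2 : τ (h * y * h) ≠ ∞ := by
    have hle := CStarAlgebra.star_left_conjugate_le_norm_smul (a := h) (b := y)
    rw [hh.star_eq] at hle
    refine ((τ.mono pos_hyh hle).trans_lt ?_).ne
    have := τ.map_smul ‖y‖₊ (h * h) pos_hh
    rw [coe_nnnorm] at this
    rw [this]
    exact ENNReal.mul_lt_top (by simp) hfin.lt_top
  -- traciality for `u = h + h y`, with the unit removed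
  have tr : τ (star (h + h * y) * (h + h * y))
      = τ (h * h) + (τ (h * y * h) + τ (h * y * h)) + τ (h * (y * y) * h) := by
    rw [τ.tracial, ← τ.map_add _ _ pos_hyh pos_hyh, ← τ.map_add _ _ pos_hh
      (add_nonneg pos_hyh pos_hyh), ← τ.map_add _ _ (add_nonneg pos_hh
      (add_nonneg pos_hyh pos_hyh)) pos_hyyh]
    congr 1
    simp only [star_add, star_mul, hh.star_eq, hys.star_eq, add_mul, mul_add, mul_assoc]
    abel
  -- The cross terms `x y + y x` are isolated by an identity whose two sides are sums of positive
  -- elements, since `τ` is additive only on `A₊`. With `tr` and `e1`, the finite terms `τ(h²)` and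
  -- `τ(y h² y)` cancel.
  have key : star (h + h * y) * (h + h * y) + (h * h * (h * h) + y * y)
      = star (h * h + y) * (h * h + y) + (h * h + y * (h * h) * y) := by
    simp only [star_add, star_mul, hh.star_eq, hys.star_eq, add_mul, mul_add, mul_assoc]
    abel
  have h3 := congrArg τ.toFun key
  rw [τ.map_add _ _ (P _) (add_nonneg pos_hhhh pos_yy), τ.map_add _ _ pos_hhhh pos_yy,
    τ.map_add _ _ (P _) (add_nonneg pos_hh pos_yhhy), τ.map_add _ _ pos_hh pos_yhhy, tr, e1] at h3
  have f3 : τ (star (h * h + y) * (h * h + y)) ≠ ∞ := (add_mem hx hy').ne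
  have h4 := congrArg ENNReal.toReal h3
  have add {a b : ℝ≥0∞} (ha : a ≠ ∞) (hb : b ≠ ∞) := ENNReal.toReal_add ha hb
  have fin {a b : ℝ≥0∞} (ha : a ≠ ∞) (hb : b ≠ ∞) : a + b ≠ ∞ := ENNReal.add_ne_top.2 ⟨ha, hb⟩
  rw [add (fin (fin hfin (fin f2 f2)) f1) (fin fx fy), add (fin hfin (fin f2 f2)) f1,
    add hfin (fin f2 f2), add f2 f2, add fx fy, add f3 (fin hfin f1), add hfin f1] at h4
  have h5 := norm_add_sq (𝕜 := ℂ) (τ.toL2 (h * h) hx) (τ.toL2 y hy')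
  rw [← τ.toL2_add, norm_toL2_sq, norm_toL2_sq, norm_toL2_sq, hxs, hys.star_eq] at h5
  simp only [RCLike.re_to_complex] at h5
  linarith

theorem re_inner_toL2_nonneg {e y : A} (he : 0 ≤ e) (hy : 0 ≤ y)
    (he' : e ∈ τ.sqInt) (hy' : y ∈ τ.sqInt) (hfin : τ e ≠ ∞) :
    0 ≤ (inner ℂ (τ.toL2 e he') (τ.toL2 y hy')).re := by
  obtain ⟨h, hh, rfl⟩ : ∃ h : A, IsSelfAdjoint h ∧ h * h = e :=
    ⟨CFC.sqrt e, .of_nonneg (CFC.sqrt_nonneg e), CFC.sqrt_mul_sqrt_self e⟩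
  rw [τ.re_inner_toL2_mul_self hh hy he' hy' hfin]
  exact ENNReal.toReal_nonneg

theorem re_inner_toL2_le {e y : A} (he : 0 ≤ e) (hy : 0 ≤ y)
    (he' : e ∈ τ.sqInt) (hy' : y ∈ τ.sqInt) (hfin : τ e ≠ ∞) :
    (inner ℂ (τ.toL2 e he') (τ.toL2 y hy')).re ≤ ‖y‖ * (τ e).toReal := by
  obtain ⟨h, hh, rfl⟩ : ∃ h : A, IsSelfAdjoint h ∧ h * h = e :=
    ⟨CFC.sqrt e, .of_nonneg (CFC.sqrt_nonneg e), CFC.sqrt_mul_sqrt_self e⟩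
  rw [τ.re_inner_toL2_mul_self hh hy he' hy' hfin]
  have hle := CStarAlgebra.star_left_conjugate_le_norm_smul (a := h) (b := y)
  rw [hh.star_eq] at hle
  have h1 := τ.map_smul ‖y‖₊ (h * h) he
  rw [coe_nnnorm] at h1
  have h2 := τ.mono (hh.conjugate_nonneg hy) hle
  rw [h1] at h2
  have h3 := ENNReal.toReal_mono (ENNReal.mul_ne_top (by simp) hfin) h2
  simpa using h3

/-- For `c ≤ 1` the term `-c⁻` only lowers the pairing with `e`, and `‖c⁺‖ ≤ 1`; the bound passes to
the closure. It replaces the pairing of `e` with a unit, which need not lie in `L²`. -/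
theorem re_inner_toL2_le_of_mem_leOneSet {e : A} (he : 0 ≤ e) (he' : e ∈ τ.sqInt)
    (hfin : τ e ≠ ∞) {η : τ.L2} (hη : η ∈ τ.leOneSet) :
    (inner ℂ (τ.toL2 e he') η).re ≤ (τ e).toReal := by
  have hcl : IsClosed {η : τ.L2 | (inner ℂ (τ.toL2 e he') η).re ≤ (τ e).toReal} :=
    isClosed_le (by fun_prop) continuous_const
  refine closure_minimal ?_ hcl hη
  rintro _ ⟨c, hc, hc1, rfl⟩
  have hcp := τ.posPart_mem_sqInt hc hc1.1
  have hcn := τ.negPart_mem_sqInt hc hc1.1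
  have e1 : τ.toL2 c hc = τ.toL2 c⁺ hcp - τ.toL2 c⁻ hcn := by
    rw [← τ.toL2_sub]
    exact τ.toL2_congr (CFC.posPart_sub_negPart c hc1.1).symm _ _
  have h1 := τ.re_inner_toL2_nonneg he (CFC.negPart_nonneg c) he' hcn hfin
  have h2 := τ.re_inner_toL2_le he (CFC.posPart_nonneg c) he' hcp hfin
  have hcn1 : ‖c⁺‖ ≤ 1 := by
    rw [CFC.posPart_def]
    refine norm_cfcₙ_le fun x hx => ?_
    rw [Real.norm_of_nonneg (posPart_nonneg x)]
    exact sup_le (hc1.2 x hx) zero_le_one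
  have h3 := mul_le_mul_of_nonneg_right hcn1
    (ENNReal.toReal_nonneg (a := τ e))
  rw [Set.mem_ofPred_eq, e1, inner_sub_right, Complex.sub_re]
  linarith

/-- Makes multiples of `-b⁻` admissible competitors for the projection onto `leOneSet`. -/
theorem selfAdjointLeOne_of_nonpos {c : A} (hc : c ≤ 0) : SelfAdjointLeOne c := by
  have hn : 0 ≤ -c := neg_nonneg.2 hc
  have hsa : IsSelfAdjoint (-c) := .of_nonneg hn
  have e : c = cfcₙ (fun x : ℝ => -x) (-c) := by rw [cfcₙ_neg_id (R := ℝ) (-c) hsa, neg_neg]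
  refine ⟨by simpa using hsa.neg, fun x hx => ?_⟩
  rw [e, cfcₙ_map_quasispectrum (fun x : ℝ => -x) (-c) (by fun_prop) neg_zero hsa] at hx
  obtain ⟨y, hy, rfl⟩ := hx
  have := quasispectrum_nonneg_of_nonneg (-c) hn y hy
  linarith

/-- Lower semicontinuity of `τ`, in metric form. -/
theorem exists_le_add_of_norm_sub_lt {x : A} (hx : 0 ≤ x) (hfin : τ x ≠ ∞) {c : ℝ≥0∞}
    (hc : c ≠ 0) : ∃ r > 0, ∀ a : A, 0 ≤ a → ‖a - x‖ < r → τ x ≤ τ a + c := by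
  rcases eq_or_ne (τ x) 0 with h0 | h0
  · exact ⟨1, one_pos, fun a _ _ => by simp [h0]⟩
  have h := τ.lowerSemicontinuous x hx (τ x - c) (ENNReal.sub_lt_self hfin h0 hc)
  rw [eventually_nhdsWithin_iff, Metric.eventually_nhds_iff] at h
  obtain ⟨r, hr, h⟩ := h
  refine ⟨r, hr, fun a ha har => ?_⟩
  rw [← dist_eq_norm] at har
  exact tsub_le_iff_right.1 (h har ha).le

/-- The positive part of a square integrable element is approximated in `L²` by positive
elements of finite trace. -/
theorem exists_finite_trace_near_posPart {b : A} (hb : b ∈ τ.sqInt) (hsa : IsSelfAdjoint b)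
    {κ : ℝ} (hκ : 0 < κ) :
    ∃ (e : A) (he : e ∈ τ.sqInt), 0 ≤ e ∧ τ e ≠ ∞ ∧
      ‖τ.toL2 b⁺ (τ.posPart_mem_sqInt hb hsa) - τ.toL2 e he‖ ≤ κ := by
  have hp := τ.posPart_mem_sqInt hb hsa
  have hps : IsSelfAdjoint b⁺ := .of_nonneg (CFC.posPart_nonneg b)
  have pos_pp : 0 ≤ b⁺ * b⁺ := by simpa [hps.star_eq] using star_mul_self_nonneg b⁺
  have fpp : τ (b⁺ * b⁺) ≠ ∞ := by
    have h : τ (star b⁺ * b⁺) < ∞ := hp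
    rw [hps.star_eq] at h
    exact h.ne
  obtain ⟨r, hr, hlsc⟩ := τ.exists_le_add_of_norm_sub_lt pos_pp fpp
    (c := ENNReal.ofReal (κ ^ 2)) (by simp; positivity)
  obtain ⟨δ, hδ, hδr⟩ : ∃ δ : ℝ, 0 < δ ∧ δ ^ 2 < r :=
    ⟨Real.sqrt (r / 2), by positivity, by rw [Real.sq_sqrt (by positivity)]; linarith⟩
  -- Split `x⁺ = f + g`: `f` vanishes below `δ`, so `f(b)` has finite trace, and `g ≤ δ` makes
  -- `g(b)` small in norm. The choice `δ² < r` lets semicontinuity at `(b⁺)²` absorb `g(b)²`.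
  set f : ℝ → ℝ := fun x => max (x - δ) 0 with hf
  set g : ℝ → ℝ := fun x => min (max x 0) δ with hg
  have f0 : f 0 = 0 := by simp [hf, hδ.le]
  have g0 : g 0 = 0 := by simp [hg, hδ.le]
  have fc : Continuous f := by fun_prop
  have gc : Continuous g := by fun_prop
  have hfg : ∀ x : ℝ, x⁺ = f x + g x := by
    intro x
    rw [posPart_def]
    simp only [hf, hg]
    rcases le_total x 0 with h | h <;> rcases le_total x δ with h' | h' <;>
      (simp [h, h', hδ.le]; try linarith)
  have gn : ∀ x, 0 ≤ g x := fun x => le_min (le_max_right _ _) hδ.le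
  have gle : ∀ x, g x ≤ x⁺ := fun x => min_le_left _ _
  have fn : ∀ x, 0 ≤ f x := fun x => le_max_right _ _
  have xple : ∀ x : ℝ, x⁺ ≤ |x| := fun x => sup_le (le_abs_self x) (abs_nonneg x)
  have fmem : cfcₙ f b ∈ τ.sqInt := τ.cfcₙ_mem_sqInt hb hsa fc f0 fun x => by
    rw [abs_of_nonneg (fn x)]; linarith [hfg x, gn x, xple x]
  have gmem : cfcₙ g b ∈ τ.sqInt := τ.cfcₙ_mem_sqInt hb hsa gc g0 fun x => by
    rw [abs_of_nonneg (gn x)]; linarith [gle x, xple x]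
  have esum : b⁺ = cfcₙ f b + cfcₙ g b := by
    rw [CFC.posPart_def, ← cfcₙ_add f g b fc.continuousOn f0 gc.continuousOn g0]
    exact cfcₙ_congr fun x _ => hfg x
  have pc : Continuous fun x : ℝ => x⁺ := continuous_id.sup continuous_const
  have epp : b⁺ * b⁺ = cfcₙ (fun x : ℝ => x⁺ * x⁺) b := by
    rw [CFC.posPart_def]
    exact (cfcₙ_mul (fun x : ℝ => x⁺) (fun x : ℝ => x⁺) b pc.continuousOn posPart_zero
      pc.continuousOn posPart_zero).symm
  have ppc : ContinuousOn (fun x : ℝ => x⁺ * x⁺) (quasispectrum ℝ b) := (pc.mul pc).continuousOn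
  have pp0 : (0 : ℝ)⁺ * (0 : ℝ)⁺ = 0 := by simp
  refine ⟨cfcₙ f b, fmem, cfcₙ_nonneg fun x _ => fn x, ?_, ?_⟩
  · have hle : cfcₙ f b ≤ (δ⁻¹ : ℝ) • (b⁺ * b⁺) := by
      rw [epp, ← cfcₙ_const_mul δ⁻¹ (fun x : ℝ => x⁺ * x⁺) b ppc pp0]
      refine cfcₙ_mono (fun x _ => ?_) fc.continuousOn (continuousOn_const.mul ppc) f0
        (by rw [pp0, mul_zero])
      rcases le_total x δ with h | h
      · have : f x = 0 := by simp [hf, h]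
        rw [this]
        have := posPart_nonneg x
        positivity
      · have h0 : 0 ≤ x := hδ.le.trans h
        rw [posPart_of_nonneg h0, le_inv_mul_iff₀ hδ]
        have : f x = x - δ := by simp [hf, h]
        rw [this]
        nlinarith
    refine ((τ.mono (cfcₙ_nonneg fun x _ => fn x) hle).trans_lt ?_).ne
    have := τ.map_smul (Real.toNNReal δ⁻¹) (b⁺ * b⁺) pos_pp
    rw [Real.coe_toNNReal _ (by positivity)] at this
    rw [this]
    exact ENNReal.mul_lt_top (by simp) fpp.lt_top
  · have eg : τ.toL2 b⁺ hp - τ.toL2 (cfcₙ f b) fmem = τ.toL2 (cfcₙ g b) gmem := by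
      rw [← τ.toL2_sub]
      exact τ.toL2_congr (by rw [esum]; abel) _ _
    rw [eg]
    refine (pow_le_pow_iff_left₀ (norm_nonneg _) hκ.le two_ne_zero).1 ?_
    rw [norm_toL2_sq]
    set G := cfcₙ g b
    have Gs : IsSelfAdjoint G := IsSelfAdjoint.cfcₙ
    rw [Gs.star_eq]
    have pos_GG : 0 ≤ G * G := by simpa [Gs.star_eq] using star_mul_self_nonneg G
    have GG : G * G ≤ b⁺ * b⁺ := by
      rw [epp, ← cfcₙ_mul g g b gc.continuousOn g0 gc.continuousOn g0]
      exact cfcₙ_mono (fun x _ => mul_self_le_mul_self (gn x) (gle x))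
        (gc.mul gc).continuousOn ppc (by rw [g0, mul_zero]) pp0
    have Gn : ‖G‖ ≤ δ := norm_cfcₙ_le fun x _ => by
      rw [Real.norm_of_nonneg (gn x)]; exact min_le_right _ _
    -- Removing `G²` costs at most `κ²` of trace by semicontinuity; by additivity that cost is
    -- exactly `τ(G²) = ‖g(b)‖₂²`.
    have h1 := hlsc (b⁺ * b⁺ - G * G) (sub_nonneg.2 GG) (by
      rw [sub_sub_cancel_left, norm_neg]
      refine ((norm_mul_le G G).trans ?_).trans_lt hδr
      rw [pow_two]
      exact mul_self_le_mul_self (norm_nonneg _) Gn)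
    have h2 := τ.map_add (b⁺ * b⁺ - G * G) (G * G) (sub_nonneg.2 GG) pos_GG
    rw [sub_add_cancel] at h2
    rw [h2] at h1
    have h3 : τ (b⁺ * b⁺ - G * G) ≠ ∞ := by
      intro h; rw [h2, h] at fpp; simp at fpp
    have h4 := (ENNReal.add_le_add_iff_left h3).1 h1
    have h5 := ENNReal.toReal_mono ENNReal.ofReal_ne_top h4
    rwa [ENNReal.toReal_ofReal (by positivity)] at h5

end CStarTrace

/-! ### Energies -/

namespace SesqForm

variable {H : Type*} [NormedAddCommGroup H] [InnerProductSpace ℂ H] {E : SesqForm H}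

theorem IsNonneg.energy_nonneg (hE : E.IsNonneg) (ξ : E.domain) : 0 ≤ E.energy ξ :=
  (Complex.nonneg_iff.1 (hE ξ)).1

theorem energy_smul (c : ℂ) (ξ : E.domain) : E.energy (c • ξ) = ‖c‖ ^ 2 * E.energy ξ := by
  have h : E.form (c • ξ) (c • ξ) = ((‖c‖ ^ 2 : ℝ) : ℂ) * E.form ξ ξ := by
    rw [map_smul, LinearMap.map_smulₛₗ, LinearMap.smul_apply, smul_eq_mul, smul_eq_mul,
      ← mul_assoc, Complex.mul_conj', Complex.ofReal_pow]
  rw [energy, h, Complex.re_ofReal_mul, energy]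

/-- `E(ζ, ζ)` is real; take imaginary parts at `ζ = ξ + iη`. -/
theorem IsNonneg.re_form_comm (hE : E.IsNonneg) (ξ η : E.domain) :
    (E.form ξ η).re = (E.form η ξ).re := by
  have him (ζ : E.domain) : (E.form ζ ζ).im = 0 := (Complex.nonneg_iff.1 (hE ζ)).2.symm
  have h := him (ξ + Complex.I • η)
  simp only [map_add, LinearMap.add_apply, map_smul, LinearMap.map_smulₛₗ, LinearMap.smul_apply,
    smul_eq_mul, Complex.add_im, Complex.add_re, Complex.mul_im, Complex.mul_re, Complex.I_re, Complex.I_im,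
    Complex.conj_I, Complex.neg_re, Complex.neg_im, him] at h
  linarith

theorem IsNonneg.energy_add (hE : E.IsNonneg) (ξ η : E.domain) :
    E.energy (ξ + η) = E.energy ξ + 2 * (E.form ξ η).re + E.energy η := by
  simp only [energy, map_add, LinearMap.add_apply, Complex.add_re, hE.re_form_comm η ξ]
  ring

theorem IsNonneg.energy_sub (hE : E.IsNonneg) (ξ η : E.domain) :
    E.energy (ξ - η) = E.energy ξ - 2 * (E.form ξ η).re + E.energy η := by
  simp only [energy, map_sub, LinearMap.sub_apply, Complex.sub_re, hE.re_form_comm η ξ]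
  ring

theorem energy_neg (ξ : E.domain) : E.energy (-ξ) = E.energy ξ := by
  simpa using E.energy_smul (-1) ξ

/-- Young's inequality for the cross term, from `E[tξ - η] ≥ 0` divided by `t`. -/
theorem IsNonneg.energy_add_le (hE : E.IsNonneg) (ξ η : E.domain) {t : ℝ} (ht : 0 < t) :
    E.energy (ξ + η) ≤ (1 + t) * E.energy ξ + (1 + t⁻¹) * E.energy η := by
  have h := hE.energy_nonneg ((t : ℂ) • ξ - η)
  rw [hE.energy_sub, energy_smul, LinearMap.map_smulₛₗ, LinearMap.smul_apply, smul_eq_mul,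
    Complex.conj_ofReal, Complex.re_ofReal_mul, Complex.norm_real, Real.norm_eq_abs, sq_abs] at h
  rw [hE.energy_add]
  have h2 := mul_le_mul_of_nonneg_left h (inv_nonneg.2 ht.le)
  have e : t⁻¹ * (t ^ 2 * E.energy ξ - 2 * (t * (E.form ξ η).re) + E.energy η)
      = t * E.energy ξ - 2 * (E.form ξ η).re + t⁻¹ * E.energy η := by
    field_simp
  rw [e] at h2
  linarith

/-- Lower semicontinuity of the energy of a closed form. -/
theorem IsClosedForm.exists_energy_le (hc : E.IsClosedForm) (hE : E.IsNonneg) {u : H} {M : ℝ}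
    (h : ∀ ε : ℝ, 0 < ε → ∃ v : E.domain, ‖(v : H) - u‖ ≤ ε ∧ E.energy v ≤ M) :
    ∃ hu : u ∈ E.domain, E.energy ⟨u, hu⟩ ≤ M := by
  set d : ℕ → ℝ := fun n => 1 / ((n : ℝ) + 1) with hd
  have d_pos (n : ℕ) : 0 < d n := Nat.one_div_pos_of_nat
  have d_anti : Antitone d := fun m n hmn => Nat.one_div_le_one_div hmn
  have d_lim : Filter.Tendsto d Filter.atTop (nhds 0) := tendsto_one_div_add_atTop_nhds_zero_nat
  set K : ℕ → Set ℝ := fun n => E.energy '' {v | ‖(v : H) - u‖ ≤ d n} with hK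
  have K_bdd (n : ℕ) : BddBelow (K n) := ⟨0, by rintro _ ⟨v, -, rfl⟩; exact hE.energy_nonneg v⟩
  have K_anti {m n : ℕ} (hmn : m ≤ n) : K n ⊆ K m := Set.image_mono fun v hv =>
    le_trans hv (d_anti hmn)
  have K_ne (n : ℕ) : (K n).Nonempty := by
    obtain ⟨v, hv, -⟩ := h _ (d_pos n)
    exact ⟨_, v, hv, rfl⟩
  -- Approximants of bounded energy need not be Cauchy for the form, so near-minimizers of the
  -- energy over shrinking balls around `u` are used. The infima increase and are bounded by `M`.
  set I : ℕ → ℝ := fun n => sInf (K n) with hI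
  have I_mono : Monotone I := fun m n hmn => csInf_le_csInf (K_bdd m) (K_ne n) (K_anti hmn)
  have I_le (n : ℕ) : I n ≤ M := by
    obtain ⟨v, hv, hvM⟩ := h _ (d_pos n)
    exact (csInf_le (K_bdd n) ⟨v, hv, rfl⟩).trans hvM
  have I_bdd : BddAbove (Set.range I) := ⟨M, by rintro _ ⟨n, rfl⟩; exact I_le n⟩
  have I_lim := tendsto_atTop_ciSup I_mono I_bdd
  have I_sup (n : ℕ) : I n ≤ ⨆ i, I i := le_ciSup I_bdd n
  have sup_le : ⨆ i, I i ≤ M := ciSup_le I_le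
  have ex (n : ℕ) : ∃ v : E.domain, ‖(v : H) - u‖ ≤ d n ∧ E.energy v < I n + d n := by
    obtain ⟨_, ⟨v, hv, rfl⟩, hlt⟩ := exists_lt_of_csInf_lt (K_ne n)
      (lt_add_of_pos_right (I n) (d_pos n))
    exact ⟨v, hv, hlt⟩
  choose v hv hvE using ex
  have v_lim : Filter.Tendsto (fun k => (v k : H)) Filter.atTop (nhds u) := by
    rw [tendsto_iff_norm_sub_tendsto_zero]
    exact squeeze_zero (fun _ => norm_nonneg _) hv d_lim
  have v_cauchy : ∀ ε : ℝ, 0 < ε → ∃ N, ∀ k ≥ N, ∀ l ≥ N, E.energy (v k - v l) < ε := by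
    intro ε hε
    have lim : Filter.Tendsto (fun n => 4 * (⨆ i, I i) + 4 * d n - 4 * I n) Filter.atTop
        (nhds (4 * (⨆ i, I i) + 4 * 0 - 4 * ⨆ i, I i)) :=
      (tendsto_const_nhds.add (d_lim.const_mul 4)).sub (I_lim.const_mul 4)
    obtain ⟨N, hN⟩ := (lim.eventually_lt_const (u := ε) (by linarith)).exists
    refine ⟨N, fun k hk l hl => ?_⟩
    -- Midpoints stay in the ball, so their energy is at least `I N`; the parallelogram identity
    -- then bounds `E[v k - v l]`.
    have mid : I N ≤ E.energy ((1 / 2 : ℂ) • (v k + v l)) := by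
      refine csInf_le (K_bdd N) ⟨_, ?_, rfl⟩
      have e : (((1 / 2 : ℂ) • (v k + v l) : E.domain) : H) - u
          = (1 / 2 : ℂ) • (((v k : H) - u) + ((v l : H) - u)) := by
        have : u = (1 / 2 : ℂ) • (u + u) := by
          rw [← two_smul ℂ u, smul_smul]; norm_num
        nth_rewrite 1 [this]
        rw [Submodule.coe_smul, Submodule.coe_add, ← smul_sub]
        congr 1
        abel
      rw [Set.mem_ofPred_eq, e, norm_smul]
      have h1 := norm_add_le ((v k : H) - u) ((v l : H) - u)
      have h2 := (hv k).trans (d_anti hk)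
      have h3 := (hv l).trans (d_anti hl)
      have h4 : ‖(1 / 2 : ℂ)‖ = 1 / 2 := by norm_num
      rw [h4]
      linarith
    have h4 : ‖(1 / 2 : ℂ)‖ = 1 / 2 := by norm_num
    rw [energy_smul, hE.energy_add, h4] at mid
    rw [hE.energy_sub]
    have h1 := hvE k
    have h2 := hvE l
    have h3 := d_anti hk
    have h5 := d_anti hl
    have h6 := I_sup k
    have h7 := I_sup l
    linarith
  obtain ⟨hu, hlim⟩ := hc v u v_lim v_cauchy
  refine ⟨hu, le_of_forall_pos_le_add fun s hs => ?_⟩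
  have M0 : 0 ≤ M := by
    obtain ⟨w, -, hw⟩ := h 1 one_pos
    exact (hE.energy_nonneg w).trans hw
  set t : ℝ := s / (M + 1) with ht
  have t0 : 0 < t := by positivity
  have bound (k : ℕ) : E.energy ⟨u, hu⟩ ≤
      (1 + t) * (M + d k) + (1 + t⁻¹) * E.energy (v k - ⟨u, hu⟩) := by
    have h1 := hE.energy_add_le (v k) (-(v k - ⟨u, hu⟩)) t0
    rw [energy_neg, neg_sub, add_sub_cancel] at h1
    have h2 : E.energy (v k) ≤ M + d k := by
      have := hvE k
      have := I_le k
      linarith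
    have h3 := mul_le_mul_of_nonneg_left h2 (by positivity : 0 ≤ 1 + t)
    linarith
  have lim : Filter.Tendsto (fun k => (1 + t) * (M + d k)
      + (1 + t⁻¹) * E.energy (v k - ⟨u, hu⟩)) Filter.atTop
      (nhds ((1 + t) * (M + 0) + (1 + t⁻¹) * 0)) :=
    ((tendsto_const_nhds.add d_lim).const_mul _).add (hlim.const_mul _)
  have h1 := ge_of_tendsto' lim bound
  have h2 : t * M ≤ s := by
    rw [ht, div_mul_eq_mul_div, div_le_iff₀ (by positivity)]
    nlinarith
  linarith

/-! ### The graph inner product -/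

/-- The square of the graph norm, `⟨ξ, ξ⟩_F = E[ξ] + ‖ξ‖²`. -/
def graphEnergy (E : SesqForm H) (ξ : E.domain) : ℝ := E.energy ξ + ‖(ξ : H)‖ ^ 2

theorem IsNonneg.graphEnergy_nonneg (hE : E.IsNonneg) (ξ : E.domain) : 0 ≤ E.graphEnergy ξ :=
  add_nonneg (hE.energy_nonneg ξ) (sq_nonneg _)

theorem IsNonneg.norm_sq_le_graphEnergy (hE : E.IsNonneg) (ξ : E.domain) :
    ‖(ξ : H)‖ ^ 2 ≤ E.graphEnergy ξ :=
  le_add_of_nonneg_left (hE.energy_nonneg ξ)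

theorem IsNonneg.graphEnergy_add (hE : E.IsNonneg) (ξ η : E.domain) :
    E.graphEnergy (ξ + η) = E.graphEnergy ξ + 2 * (E.graphInner ξ η).re + E.graphEnergy η := by
  have h := norm_add_sq (𝕜 := ℂ) (ξ : H) (η : H)
  rw [RCLike.re_to_complex] at h
  rw [graphEnergy, Submodule.coe_add, h, hE.energy_add, graphInner, Complex.add_re, graphEnergy,
    graphEnergy]
  ring

theorem IsNonneg.graphEnergy_sub (hE : E.IsNonneg) (ξ η : E.domain) :
    E.graphEnergy (ξ - η) = E.graphEnergy ξ - 2 * (E.graphInner ξ η).re + E.graphEnergy η := by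
  have h := norm_sub_sq (𝕜 := ℂ) (ξ : H) (η : H)
  rw [RCLike.re_to_complex] at h
  rw [graphEnergy, Submodule.coe_sub, h, hE.energy_sub, graphInner, Complex.add_re, graphEnergy,
    graphEnergy]
  ring

theorem re_graphInner_self (ξ : E.domain) : (E.graphInner ξ ξ).re = E.graphEnergy ξ := by
  rw [graphInner, Complex.add_re, graphEnergy, energy, inner_self_eq_norm_sq_to_K]
  norm_cast

theorem graphInner_sub_left (ξ η ζ : E.domain) :
    E.graphInner (ξ - η) ζ = E.graphInner ξ ζ - E.graphInner η ζ := by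
  simp only [graphInner, map_sub, LinearMap.sub_apply, Submodule.coe_sub, inner_sub_left]
  ring

theorem graphInner_add_left (ξ η ζ : E.domain) :
    E.graphInner (ξ + η) ζ = E.graphInner ξ ζ + E.graphInner η ζ := by
  simp only [graphInner, map_add, LinearMap.add_apply, Submodule.coe_add, inner_add_left]
  ring

theorem graphInner_sub_right (ξ η ζ : E.domain) :
    E.graphInner ξ (η - ζ) = E.graphInner ξ η - E.graphInner ξ ζ := by
  simp only [graphInner, map_sub, Submodule.coe_sub, inner_sub_right]
  ring

theorem graphInner_smul_right (c : ℂ) (ξ η : E.domain) :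
    E.graphInner ξ (c • η) = c * E.graphInner ξ η := by
  simp only [graphInner, map_smul, Submodule.coe_smul, inner_smul_right, smul_eq_mul]
  ring

end SesqForm

/-! ### Positive and negative parts in the Dirichlet algebra -/

section Dirichlet

variable {A : Type*} [NonUnitalCStarAlgebra A] [PartialOrder A] [StarOrderedRing A]
variable {τ : CStarTrace A} {E : SesqForm τ.L2}

namespace CStarTrace

theorem toL2_eq_posPart_sub_negPart (τ : CStarTrace A) {b : A} (hb : b ∈ τ.sqInt)
    (hsa : IsSelfAdjoint b) :
    τ.toL2 b hb = τ.toL2 b⁺ (τ.posPart_mem_sqInt hb hsa) - τ.toL2 b⁻ (τ.negPart_mem_sqInt hb hsa) := by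
  rw [← τ.toL2_sub]
  exact τ.toL2_congr (CFC.posPart_sub_negPart b hsa).symm _ _

theorem re_inner_posPart_negPart (τ : CStarTrace A) {b : A} (hb : b ∈ τ.sqInt)
    (hsa : IsSelfAdjoint b) :
    (inner ℂ (τ.toL2 b⁺ (τ.posPart_mem_sqInt hb hsa))
      (τ.toL2 b⁻ (τ.negPart_mem_sqInt hb hsa))).re = 0 := by
  refine τ.re_inner_toL2_eq_zero _ _ ?_
  rw [(IsSelfAdjoint.of_nonneg (CFC.posPart_nonneg b)).star_eq, CFC.posPart_mul_negPart]

end CStarTrace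

open CStarTrace SesqForm

/-- The truncations `b ∧ ε` of `b = b*` approximate `-b⁻` in `L²`, with energy at most `E[b]`. -/
theorem exists_near_neg_negPart (hE : E.IsMarkovian τ.J τ.leOneSet) {b : A} (hb : b ∈ τ.sqInt)
    (hsa : IsSelfAdjoint b) (hbE : τ.toL2 b hb ∈ E.domain) {κ : ℝ} (hκ : 0 < κ) :
    ∃ v : E.domain, ‖(v : τ.L2) + τ.toL2 b⁻ (τ.negPart_mem_sqInt hb hsa)‖ ≤ κ ∧
      E.energy v ≤ E.energy ⟨τ.toL2 b hb, hbE⟩ := by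
  set P := τ.toL2 b⁺ (τ.posPart_mem_sqInt hb hsa) with hP
  set N := τ.toL2 b⁻ (τ.negPart_mem_sqInt hb hsa) with hN
  have hPN : τ.toL2 b hb = P - N := τ.toL2_eq_posPart_sub_negPart hb hsa
  have orth : (inner ℂ P N).re = 0 := τ.re_inner_posPart_negPart hb hsa
  set R : ℝ := 2 * ‖P‖ + ‖N‖ with hR
  have R0 : 0 ≤ R := by positivity
  -- `P` may have infinite trace, so it is replaced by `e` of finite trace, at a cost of at most
  -- `κ²/4` against vectors of norm at most `R`. Afterwards `ε` is chosen so that `ε τ(e) ≤ κ²/4`.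
  obtain ⟨e, he, epos, efin, hPe⟩ := τ.exists_finite_trace_near_posPart hb hsa
    (κ := κ ^ 2 / (4 * (R + 1))) (by positivity)
  rw [← hP] at hPe
  set T : ℝ := (τ e).toReal with hT
  have T0 : 0 ≤ T := ENNReal.toReal_nonneg
  set ε : ℝ := κ ^ 2 / (4 * (T + 1)) with hε
  have ε0 : 0 < ε := by positivity
  have εC : (ε : ℂ) ≠ 0 := by exact_mod_cast ε0.ne'
  set B : E.domain := ⟨τ.toL2 b hb, hbE⟩ with hB
  have hJ : τ.J (((ε⁻¹ : ℝ) : ℂ) • B : E.domain) = (((ε⁻¹ : ℝ) : ℂ) • B : E.domain) := by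
    rw [Submodule.coe_smul, hB, ← τ.toL2_real_smul, τ.J_toL2]
    exact τ.toL2_congr (by simp [hsa.star_eq]) _ _
  obtain ⟨η, ⟨hηC, hηmin⟩, hηE⟩ := hE _ hJ
  -- Comparing the projection of `b/ε` with the competitor `-b⁻/ε` gives, after rescaling, `‖b - V‖
  -- ≤ ‖b + b⁻‖ = ‖b⁺‖` for `V = εη`.
  have hneg : (-ε⁻¹ : ℝ) • b⁻ ≤ 0 :=
    smul_nonpos_of_nonpos_of_nonneg (by simpa using ε0.le) (CFC.negPart_nonneg b)
  have h1 := hηmin _ (subset_closure ⟨_, τ.real_smul_mem_sqInt (-ε⁻¹)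
    (τ.negPart_mem_sqInt hb hsa), selfAdjointLeOne_of_nonpos hneg, rfl⟩)
  rw [τ.toL2_real_smul _ (τ.negPart_mem_sqInt hb hsa), ← hN, Submodule.coe_smul] at h1
  have scale (x y : τ.L2) : ‖x - (ε : ℂ) • y‖ = ε * ‖((ε⁻¹ : ℝ) : ℂ) • x - y‖ := by
    have : x - (ε : ℂ) • y = (ε : ℂ) • (((ε⁻¹ : ℝ) : ℂ) • x - y) := by
      rw [smul_sub, smul_smul, Complex.ofReal_inv, mul_inv_cancel₀ εC, one_smul]
    rw [this, norm_smul, Complex.norm_real, Real.norm_of_nonneg ε0.le]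
  refine ⟨(ε : ℂ) • η, ?_, ?_⟩
  swap
  · rw [energy_smul]
    rw [energy_smul] at hηE
    have h2 := mul_le_mul_of_nonneg_left hηE (sq_nonneg ‖(ε : ℂ)‖)
    refine h2.trans_eq ?_
    rw [Complex.norm_real, Complex.norm_real, Real.norm_eq_abs, Real.norm_eq_abs, sq_abs, sq_abs]
    field_simp
  rw [Submodule.coe_smul]
  set V : τ.L2 := (ε : ℂ) • (η : τ.L2) with hV
  have h2 : ‖P - (V + N)‖ ≤ ‖P‖ := by
    have h3 := mul_le_mul_of_nonneg_left h1 ε0.le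
    rw [← scale, ← scale, smul_smul, ← Complex.ofReal_mul, mul_neg, mul_inv_cancel₀ ε0.ne'] at h3
    have e1 : (B : τ.L2) = P - N := hPN
    rw [e1, ← hV, show ((-1 : ℝ) : ℂ) • N = -N by simp, sub_neg_eq_add, sub_add_cancel] at h3
    rwa [add_comm V N, ← sub_sub]
  -- Expand the square of `h2`; the term in `(P, N)` vanishes by orthogonality.
  have h3 : ‖V + N‖ ^ 2 ≤ 2 * (inner ℂ P V).re := by
    have h4 := norm_sub_sq (𝕜 := ℂ) P (V + N)
    have h5 := pow_le_pow_left₀ (norm_nonneg _) h2 2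
    rw [h4, inner_add_right, RCLike.re_to_complex, Complex.add_re, orth] at h5
    linarith
  have hVR : ‖V‖ ≤ R := by
    have h4 : ‖V + N‖ ≤ 2 * ‖P‖ := by
      have := norm_sub_le P (P - (V + N))
      rw [sub_sub_cancel] at this
      linarith
    have := norm_sub_le (V + N) N
    rw [add_sub_cancel_right] at this
    linarith
  have h4 : (inner ℂ P V).re = (inner ℂ (P - τ.toL2 e he) V).re + (inner ℂ (τ.toL2 e he) V).re := by
    rw [inner_sub_left, Complex.sub_re]; ring
  have h5 : (inner ℂ (P - τ.toL2 e he) V).re ≤ κ ^ 2 / 4 := by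
    calc (inner ℂ (P - τ.toL2 e he) V).re ≤ ‖P - τ.toL2 e he‖ * ‖V‖ :=
          (Complex.re_le_norm _).trans (norm_inner_le_norm _ _)
      _ ≤ κ ^ 2 / (4 * (R + 1)) * R := by gcongr
      _ ≤ κ ^ 2 / 4 := by
          rw [div_mul_eq_mul_div, div_le_div_iff₀ (by positivity) (by positivity)]
          nlinarith [sq_nonneg κ]
  have h6 : (inner ℂ (τ.toL2 e he) V).re ≤ κ ^ 2 / 4 := by
    calc (inner ℂ (τ.toL2 e he) V).re = ε * (inner ℂ (τ.toL2 e he) (η : τ.L2)).re := by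
          rw [hV, inner_smul_right, Complex.re_ofReal_mul]
      _ ≤ ε * T := by
          gcongr
          exact τ.re_inner_toL2_le_of_mem_leOneSet epos he efin hηC
      _ ≤ κ ^ 2 / 4 := by
          rw [hε, div_mul_eq_mul_div, div_le_div_iff₀ (by positivity) (by positivity)]
          nlinarith [sq_nonneg κ]
  refine (pow_le_pow_iff_left₀ (norm_nonneg _) hκ.le two_ne_zero).1 ?_
  linarith

/-- The negated truncations converge to `b⁻` in `L²` with energies bounded by `E[b]`, so lower
semicontinuity applies. -/
theorem energy_negPart_le (hE : E.IsDirichlet τ.J τ.leOneSet) {b : A} (hb : b ∈ τ.sqInt)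
    (hsa : IsSelfAdjoint b) (hbE : τ.toL2 b hb ∈ E.domain) :
    ∃ h : τ.toL2 b⁻ (τ.negPart_mem_sqInt hb hsa) ∈ E.domain,
      E.energy ⟨_, h⟩ ≤ E.energy ⟨τ.toL2 b hb, hbE⟩ := by
  refine hE.closed.exists_energy_le hE.nonneg fun ε hε => ?_
  obtain ⟨v, hv, hvE⟩ := exists_near_neg_negPart hE.markovian hb hsa hbE hε
  refine ⟨-v, ?_, by rwa [energy_neg]⟩
  rwa [Submodule.coe_neg, ← norm_neg, neg_sub, sub_neg_eq_add, add_comm]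

theorem posPart_mem_domain (hE : E.IsDirichlet τ.J τ.leOneSet) {b : A} (hb : b ∈ τ.sqInt)
    (hsa : IsSelfAdjoint b) (hbE : τ.toL2 b hb ∈ E.domain) :
    τ.toL2 b⁺ (τ.posPart_mem_sqInt hb hsa) ∈ E.domain := by
  obtain ⟨h, -⟩ := energy_negPart_le hE hb hsa hbE
  have := add_mem hbE h
  rwa [τ.toL2_eq_posPart_sub_negPart hb hsa, sub_add_cancel] at this

/-- `E(b⁺, b⁻) ≤ 0`. -/
theorem re_form_posPart_negPart_nonpos (hE : E.IsDirichlet τ.J τ.leOneSet) {b : A}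
    (hb : b ∈ τ.sqInt) (hsa : IsSelfAdjoint b)
    (hp : τ.toL2 b⁺ (τ.posPart_mem_sqInt hb hsa) ∈ E.domain)
    (hn : τ.toL2 b⁻ (τ.negPart_mem_sqInt hb hsa) ∈ E.domain) :
    (E.form ⟨_, hp⟩ ⟨_, hn⟩).re ≤ 0 := by
  set P : E.domain := ⟨_, hp⟩ with hP
  set N : E.domain := ⟨_, hn⟩ with hN
  -- The negative part of `s b⁺ - b⁻` is still `b⁻`, so `E[N] ≤ s² E[P] - 2s Re E(P, N) + E[N]`;
  -- cancel `E[N]` and divide by `s`.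
  have bound (s : ℝ) (hs : 0 < s) : 2 * (E.form P N).re ≤ s * E.energy P := by
    have hps := τ.real_smul_mem_sqInt s (τ.posPart_mem_sqInt hb hsa)
    have hc : s • b⁺ - b⁻ ∈ τ.sqInt := sub_mem hps (τ.negPart_mem_sqInt hb hsa)
    have hc0 : 0 ≤ s • b⁺ := smul_nonneg hs.le (CFC.posPart_nonneg b)
    have hcs : IsSelfAdjoint (s • b⁺ - b⁻) :=
      (IsSelfAdjoint.of_nonneg hc0).sub (.of_nonneg (CFC.negPart_nonneg b))
    have hcneg : (s • b⁺ - b⁻)⁻ = b⁻ :=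
      (CFC.posPart_negPart_unique (a := s • b⁺ - b⁻) rfl
        (by rw [smul_mul_assoc, CFC.posPart_mul_negPart, smul_zero]) hc0
        (CFC.negPart_nonneg b)).2
    have hcL : τ.toL2 (s • b⁺ - b⁻) hc = ((s : ℂ) • P - N : E.domain) := by
      rw [τ.toL2_sub hps (τ.negPart_mem_sqInt hb hsa), τ.toL2_real_smul]
      rfl
    have hcE : τ.toL2 (s • b⁺ - b⁻) hc ∈ E.domain := by rw [hcL]; exact Subtype.coe_prop _
    obtain ⟨h, hle⟩ := energy_negPart_le hE hc hcs hcE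
    have e1 : (⟨_, h⟩ : E.domain) = N := Subtype.ext (τ.toL2_congr hcneg _ _)
    have e2 : (⟨_, hcE⟩ : E.domain) = (s : ℂ) • P - N := Subtype.ext hcL
    rw [e1, e2, hE.nonneg.energy_sub, energy_smul, LinearMap.map_smulₛₗ, LinearMap.smul_apply,
      smul_eq_mul, Complex.conj_ofReal, Complex.re_ofReal_mul, Complex.norm_real,
      Real.norm_eq_abs, sq_abs] at hle
    have : s * (2 * (E.form P N).re) ≤ s * (s * E.energy P) := by linarith
    exact le_of_mul_le_mul_left this hs
  have h0 := hE.nonneg.energy_nonneg P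
  by_contra! hlt
  have h := bound ((E.form P N).re / (E.energy P + 1)) (by positivity)
  rw [div_mul_eq_mul_div, le_div_iff₀ (by positivity)] at h
  nlinarith

/-- Potentials are limits in `L²` of positive elements of the Dirichlet algebra. -/
theorem potentials_subset_posCone (hE : E.IsDirichlet τ.J τ.leOneSet) (hreg : IsRegular τ E) :
    potentials τ E ⊆ τ.posCone := by
  rintro ξ₀ ⟨hξ₀, hpot⟩
  set ξ : E.domain := ⟨ξ₀, hξ₀⟩
  rw [posCone, Metric.mem_closure_iff]
  intro ε hε
  obtain ⟨b, hb, hbE, hlt⟩ := hreg.2 ξ (ε ^ 2) (by positivity)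
  set B : E.domain := ⟨τ.toL2 b hb, hbE⟩
  obtain ⟨hsE, hsEn⟩ := hE.real B
  have hs : star b ∈ τ.sqInt := τ.star_mem_sqInt hb
  have hJB : τ.J B = τ.toL2 (star b) hs := τ.J_toL2 b hb
  set S : E.domain := ⟨τ.J B, hsE⟩
  set h : A := (1 / 2 : ℂ) • (b + star b) with hh
  set k : A := (-Complex.I / 2) • (b - star b) with hk
  have hsa : IsSelfAdjoint h := by
    rw [IsSelfAdjoint, hh, star_smul, star_add, star_star, add_comm]
    congr 1
    norm_num
  have ksa : IsSelfAdjoint k := by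
    rw [IsSelfAdjoint, hk, star_smul, star_sub, star_star, ← neg_sub b (star b), smul_neg,
      ← neg_smul]
    congr 1
    simp [neg_div]
  have hm : h ∈ τ.sqInt := τ.sqInt.smul_mem _ (add_mem hb hs)
  have km : k ∈ τ.sqInt := τ.sqInt.smul_mem _ (sub_mem hb hs)
  have hL : τ.toL2 h hm = ((1 / 2 : ℂ) • (B + S) : E.domain) := by
    rw [τ.toL2_smul _ (add_mem hb hs), τ.toL2_add hb hs, ← hJB]
    rfl
  have kL : τ.toL2 k km = ((-Complex.I / 2) • (B - S) : E.domain) := by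
    rw [τ.toL2_smul _ (sub_mem hb hs), τ.toL2_sub hb hs, ← hJB]
    rfl
  have hmE : τ.toL2 h hm ∈ E.domain := by rw [hL]; exact Subtype.coe_prop _
  have kmE : τ.toL2 k km ∈ E.domain := by rw [kL]; exact Subtype.coe_prop _
  set X : E.domain := (1 / 2 : ℂ) • (B + S)
  set Y : E.domain := Complex.I • ⟨τ.toL2 k km, kmE⟩ with hY
  have hY' : Y = (1 / 2 : ℂ) • (B - S) := by
    have : (⟨τ.toL2 k km, kmE⟩ : E.domain) = (-Complex.I / 2) • (B - S) := Subtype.ext kL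
    rw [hY, this, smul_smul]
    congr 1
    linear_combination (-1 / 2 : ℂ) * Complex.I_mul_I
  have eB : X + Y = B := by rw [hY']; module
  have eS : X - Y = S := by rw [hY']; module
  -- by reality of `E` and traciality, `X` and `Y` are orthogonal for the graph inner product
  have orthXY : (E.graphInner X Y).re = 0 := by
    have h1 : E.graphEnergy S = E.graphEnergy B := by
      rw [graphEnergy, graphEnergy, hsEn]
      congr 2
      exact (congrArg norm hJB).trans (τ.norm_toL2_star hb)
    rw [← eB, ← eS, hE.nonneg.graphEnergy_add, hE.nonneg.graphEnergy_sub] at h1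
    linarith
  have nonneg_of_pos {a : A} (ha : 0 ≤ a) (ham : a ∈ τ.sqInt) (haE : τ.toL2 a ham ∈ E.domain) :
      0 ≤ E.graphInner ξ ⟨τ.toL2 a ham, haE⟩ :=
    hpot a ham haE (subset_closure ⟨a, ham, ha, rfl⟩)
  -- The order on `ℂ` makes `0 ≤ z` include `Im z = 0`. Hence `ξ` pairs with `k⁺` and `k⁻` in real
  -- numbers, and with `ik` in an imaginary one.
  have orthξY : (E.graphInner ξ Y).re = 0 := by
    have kp := posPart_mem_domain hE km ksa kmE
    obtain ⟨kn, -⟩ := energy_negPart_le hE km ksa kmE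
    have e1 : (⟨τ.toL2 k km, kmE⟩ : E.domain) = ⟨_, kp⟩ - ⟨_, kn⟩ :=
      Subtype.ext (τ.toL2_eq_posPart_sub_negPart km ksa)
    have h1 := (Complex.nonneg_iff.1 (nonneg_of_pos (CFC.posPart_nonneg k) _ kp)).2
    have h2 := (Complex.nonneg_iff.1 (nonneg_of_pos (CFC.negPart_nonneg k) _ kn)).2
    rw [hY, graphInner_smul_right, e1, graphInner_sub_right, Complex.I_mul_re, Complex.sub_im,
      ← h1, ← h2]
    simp
  -- Pythagoras: the squared distance drops by exactly the graph energy of `Y`.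
  have hX : E.graphEnergy (ξ - X) ≤ E.graphEnergy (ξ - B) := by
    have e1 : ξ - X = (ξ - B) + Y := by rw [← eB]; abel
    rw [e1, hE.nonneg.graphEnergy_add, graphInner_sub_left, Complex.sub_re, orthξY]
    nth_rewrite 2 [← eB]
    rw [graphInner_add_left, Complex.add_re, orthXY, re_graphInner_self]
    have := hE.nonneg.graphEnergy_nonneg Y
    linarith
  have hp := posPart_mem_domain hE hm hsa hmE
  obtain ⟨hn, -⟩ := energy_negPart_le hE hm hsa hmE
  set P : E.domain := ⟨_, hp⟩ with hP
  set N : E.domain := ⟨_, hn⟩ with hN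
  have eX : X = P - N := Subtype.ext (hL.symm.trans (τ.toL2_eq_posPart_sub_negPart hm hsa))
  have hPN : (E.graphInner P N).re ≤ 0 := by
    have h1 := re_form_posPart_negPart_nonpos hE hm hsa hp hn
    have h2 := τ.re_inner_posPart_negPart hm hsa
    rw [graphInner, Complex.add_re]
    linarith
  have hξN := (Complex.nonneg_iff.1 (nonneg_of_pos (CFC.negPart_nonneg h) _ hn)).1
  -- The change is `-2 Re⟨ξ, N⟩ + 2 Re⟨P, N⟩ - ‖N‖²` in the graph inner product, each term being at
  -- most `0`.
  have hfin : E.graphEnergy (ξ - P) ≤ E.graphEnergy (ξ - X) := by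
    have e1 : ξ - P = (ξ - X) - N := by rw [eX]; abel
    rw [e1, hE.nonneg.graphEnergy_sub, graphInner_sub_left, Complex.sub_re]
    nth_rewrite 2 [eX]
    rw [graphInner_sub_left, Complex.sub_re, re_graphInner_self]
    have := hE.nonneg.graphEnergy_nonneg N
    linarith
  refine ⟨P, ⟨h⁺, _, CFC.posPart_nonneg h, rfl⟩, ?_⟩
  rw [dist_eq_norm]
  refine lt_of_pow_lt_pow_left₀ 2 hε.le ?_
  exact ((hE.nonneg.norm_sq_le_graphEnergy (ξ - P)).trans (hfin.trans hX)).trans_lt hlt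

end Dirichlet

end NCPotential

end

theorem proposition3p7 {A : Type*} [NonUnitalCStarAlgebra A] [PartialOrder A]
    [StarOrderedRing A] [TopologicalSpace.SeparableSpace A]
    (τ : NCPotential.CStarTrace A) (E : NCPotential.SesqForm τ.L2)
    (hE : NCPotential.IsCStarDirichlet τ E) :
    NCPotential.potentials τ E ⊆ τ.posCone :=
  NCPotential.potentials_subset_posCone hE.dirichlet hE.regular
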